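/- Let $M$ be a finite Markov decision process with $S\ge 1$ states and $A\ge 1$ actions, transition vectors $p_{s,a}$, and reward distributions $r(s,a)$ on $[0,1]$ with known means $\overline r_{s,a}$. For a stationary policy $\pi$ (deterministic or randomized) let $$g_\pi(s)=\lim_{T\to\infty}\frac1T\,\mathbb E_\pi\Big[\sum_{t=0}^{T-1} r_t \,\Big|\, s_0=s\Big]$$ be its gain, and let $g^\star=\sup_{\pi,s} g_\pi(s)$. (If $M$ is weakly communicating, $g^\star$ is the constant gain of an optimal policy; this assumption is not needed below.) Data are collected by an arbitrary sampling rule. At each step $t=1,2,\dots$ a pair $(s_t,a_t)$ is selected, possibly at random, on the basis of the past; then a reward with law $r(s_t,a_t)$ and a next state with law $p_{s_t,a_t}$ are observed. In the generative model the pair is arbitrary; in the online model $s_{t+1}$ must be the next state observed at step $t$. For $n\ge 0$ let $N^n_{s,a}$ be the number of $t\le n$ with $(s_t,a_t)=(s,a)$, and let $\hat p^n_{s,a}$ be the vector of empirical frequencies of the next states observed at those steps (the uniform vector if $N^n_{s,a}=0$). Let $\delta\in(0,1)$, $\varepsilon>0$, and $$x(\delta,y)=\log\frac{SA}{\delta}+(S-1)\log\Big(e\Big(1+\frac{y}{S-1}\Big)\Big),$$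 where the second term is $0$ if $S=1$. For $b\in\mathbb R^S$ let $U^n_{s,a}(b;\delta)$ and $L^n_{s,a}(b;\delta)$ be the maximum and the minimum of $q\cdot b$ over the probability vectors $q$ on the states such that $$N^n_{s,a}\,\mathrm{KL}(\hat p^n_{s,a},q)\le x(\delta,N^n_{s,a}),$$ with $0\cdot\infty=0$, and let $$I^{n,\sharp}_{s,a}(b;\delta)=\overline r_{s,a}+U^n_{s,a}(b;\delta)-b(s),\qquad I^{n,\flat}_{s,a}(b;\delta)=\overline r_{s,a}+L^n_{s,a}(b;\delta)-b(s).$$ Let $(b_n)_{n\ge0}$ be any sequence of vectors in $\mathbb R^S$, possibly random and dependent on the data, and let $$\tau=\tau_{\varepsilon,\delta}=\min\Big\{n\ge 0:\ \max_s\max_a I^{n,\sharp}_{s,a}(b_n;\delta)-\min_s\max_a I^{n,\flat}_{s,a}(b_n;\delta)\le\varepsilon\Big\},$$ with $\tau=\infty$ if there is no such $n$. When $\tau<\infty$, let $\widehat\pi$ be any deterministic policy with $\widehat\pi(s)\in\arg\max_a I^{\tau,\flat}_{s,a}(b_\tau;\delta)$ for every state $s$. Then $$\mathbb P\big(\tau<\infty,\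 \exists s:\ g^\star-g_{\widehat\pi}(s)>\varepsilon\big)\le\delta .$$ -/

import Mathlib

open MeasureTheory Filter Topology

noncomputable section

namespace AvgRewardMDP

/-- A finite Markov decision process: `p s a` is the probability vector of the next state and
`rew s a` the reward distribution, a probability measure carried by `[0,1]`. -/
structure MDP (S A : Type*) [Fintype S] where
  p : S → A → S → ℝ
  p_mem : ∀ s a, p s a ∈ stdSimplex ℝ S
  rew : S → A → Measure ℝ
  rew_prob : ∀ s a, IsProbabilityMeasure (rew s a)
  rew_supp : ∀ s a, rew s a (Set.Icc 0 1)ᶜ = 0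

variable {S A : Type*} [Fintype S]

/-- The (known) mean reward of a state-action pair. -/
def MDP.rbar (M : MDP S A) (s : S) (a : A) : ℝ := ∫ x, x ∂(M.rew s a)

section Gain

variable [Fintype A] [DecidableEq S]

/-- Transition matrix of the Markov chain induced by a stationary randomized policy `π`, where
`π s` is the probability vector of the action played in state `s`. -/
def MDP.policyMatrix (M : MDP S A) (π : S → A → ℝ) : Matrix S S ℝ :=
  Matrix.of fun s s' => ∑ a, π s a * M.p s a s'

/-- Mean reward of one step from state `s` under the policy `π`. -/
def MDP.policyReward (M : MDP S A) (π : S → A → ℝ) (s : S) : ℝ :=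
  ∑ a, π s a * M.rbar s a

/-- `E_π[r_t | s_0 = s]`: row `s` of the `t`-th power of the transition matrix is the law of the
state at time `t` when the chain starts in `s`. -/
def MDP.expReward (M : MDP S A) (π : S → A → ℝ) (t : ℕ) (s : S) : ℝ :=
  ((M.policyMatrix π ^ t).mulVec (M.policyReward π)) s

/-- The gain `lim_T (1/T) E_π[∑_{t<T} r_t | s_0 = s]`.  The limit exists for every policy, see
`MDP.tendsto_gain`. -/
def MDP.gain (M : MDP S A) (π : S → A → ℝ) (s : S) : ℝ :=
  limUnder atTop fun T : ℕ => (T : ℝ)⁻¹ * ∑ t ∈ Finset.range T, M.expReward π t s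

/-- Powers of a stochastic matrix act as contractions in the sup norm. -/
theorem norm_pow_mulVec_le (P : Matrix S S ℝ) (hP : ∀ s, P s ∈ stdSimplex ℝ S) (v : S → ℝ)
    (n : ℕ) : ‖(P ^ n).mulVec v‖ ≤ ‖v‖ := by
  induction n with
  | zero => simp
  | succ n ih =>
    rw [pow_succ', ← Matrix.mulVec_mulVec]
    refine le_trans ((pi_norm_le_iff_of_nonneg (norm_nonneg _)).2 fun s => ?_) ih
    set w := (P ^ n).mulVec v
    calc ‖P.mulVec w s‖ = ‖∑ s', P s s' * w s'‖ := rfl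
      _ ≤ ∑ s', ‖P s s' * w s'‖ := norm_sum_le _ _
      _ ≤ ∑ s', P s s' * ‖w‖ := by
          refine Finset.sum_le_sum fun s' _ => ?_
          rw [norm_mul, Real.norm_of_nonneg ((hP s).1 s')]
          exact mul_le_mul_of_nonneg_left (norm_le_pi_norm w s') ((hP s).1 s')
      _ = ‖w‖ := by rw [← Finset.sum_mul, (hP s).2, one_mul]

/-- Cesàro averages of the powers of a stochastic matrix converge. -/
theorem exists_tendsto_cesaro (P : Matrix S S ℝ) (hP : ∀ s, P s ∈ stdSimplex ℝ S) (v : S → ℝ) :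
    ∃ z : S → ℝ, Tendsto (fun T : ℕ => (T : ℝ)⁻¹ • ∑ t ∈ Finset.range T, (P ^ t).mulVec v)
      atTop (𝓝 z) := by
  have hlim : ∀ y : S → ℝ,
      Tendsto (fun T : ℕ => (T : ℝ)⁻¹ • ((P ^ T).mulVec y - y)) atTop (𝓝 0) := by
    intro y
    refine squeeze_zero_norm (a := fun T : ℕ => (T : ℝ)⁻¹ * (‖y‖ + ‖y‖)) (fun T => ?_) ?_
    · rw [norm_smul, Real.norm_of_nonneg (by positivity)]
      refine mul_le_mul_of_nonneg_left ?_ (by positivity)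
      exact (norm_sub_le _ _).trans (by linarith [norm_pow_mulVec_le P hP y T])
    · simpa using (tendsto_inv_atTop_nhds_zero_nat (𝕜 := ℝ)).mul_const (‖y‖ + ‖y‖)
  have hfix : ∀ z : S → ℝ, P.mulVec z = z → ∀ t : ℕ, (P ^ t).mulVec z = z := by
    intro z hz t
    induction t with
    | zero => simp
    | succ t ih => rw [pow_succ, ← Matrix.mulVec_mulVec, hz, ih]
  have htel : ∀ (y : S → ℝ) (T : ℕ),
      ∑ t ∈ Finset.range T, (P ^ t).mulVec (P.mulVec y - y) = (P ^ T).mulVec y - y := by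
    intro y T
    have h := Finset.sum_range_sub (fun t => (P ^ t).mulVec y) T
    simp only [pow_zero, Matrix.one_mulVec] at h
    rw [← h]
    refine Finset.sum_congr rfl fun t _ => ?_
    rw [Matrix.mulVec_sub, Matrix.mulVec_mulVec, pow_succ]
  have hconst : ∀ z : S → ℝ, P.mulVec z = z →
      Tendsto (fun T : ℕ => (T : ℝ)⁻¹ • ∑ t ∈ Finset.range T, (P ^ t).mulVec z)
        atTop (𝓝 z) := by
    intro z hz
    refine tendsto_const_nhds.congr' ?_
    filter_upwards [eventually_gt_atTop 0] with T hT
    have hT' : (T : ℝ) ≠ 0 := by positivity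
    simp only [hfix z hz, Finset.sum_const, Finset.card_range]
    rw [← Nat.cast_smul_eq_nsmul ℝ, smul_smul, inv_mul_cancel₀ hT', one_smul]
  set f : (S → ℝ) →ₗ[ℝ] (S → ℝ) := P.mulVecLin - 1 with hf
  have hfa : ∀ y, f y = P.mulVec y - y := fun y => rfl
  have hdisj : Disjoint (LinearMap.ker f) (LinearMap.range f) := by
    rw [Submodule.disjoint_def]
    rintro z hz ⟨y, rfl⟩
    have hz' : P.mulVec (f y) = f y := by
      have := LinearMap.mem_ker.1 hz
      rw [hfa (f y)] at this
      exact sub_eq_zero.1 this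
    have h1 := hconst _ hz'
    rw [hfa] at h1 ⊢
    simp only [htel] at h1
    exact tendsto_nhds_unique h1 (hlim y)
  have htop : LinearMap.ker f ⊔ LinearMap.range f = ⊤ :=
    Submodule.eq_top_of_disjoint _ _
      (by rw [add_comm, LinearMap.finrank_range_add_finrank_ker]) hdisj
  obtain ⟨z, hz, w, ⟨y, rfl⟩, rfl⟩ := Submodule.mem_sup.1 (htop ▸ Submodule.mem_top : v ∈ _)
  refine ⟨z, ?_⟩
  have hz' : P.mulVec z = z := sub_eq_zero.1 (LinearMap.mem_ker.1 hz)
  have := (hconst z hz').add (hlim y)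
  rw [add_zero] at this
  refine this.congr fun T => ?_
  simp only [Matrix.mulVec_add, Finset.sum_add_distrib, smul_add, hfa, htel]

/-- The limit that defines the gain exists for every stationary policy. -/
theorem MDP.tendsto_gain (M : MDP S A) (π : S → A → ℝ) (hπ : ∀ s, π s ∈ stdSimplex ℝ A) (s : S) :
    Tendsto (fun T : ℕ => (T : ℝ)⁻¹ * ∑ t ∈ Finset.range T, M.expReward π t s) atTop
      (𝓝 (M.gain π s)) := by
  have hP : ∀ s, M.policyMatrix π s ∈ stdSimplex ℝ S := by
    intro s
    refine ⟨fun s' => Finset.sum_nonneg fun a _ =>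
      mul_nonneg ((hπ s).1 a) ((M.p_mem s a).1 s'), ?_⟩
    simp only [MDP.policyMatrix, Matrix.of_apply]
    rw [Finset.sum_comm]
    simp only [← Finset.mul_sum, (M.p_mem s _).2, mul_one, (hπ s).2]
  obtain ⟨z, hz⟩ := exists_tendsto_cesaro (M.policyMatrix π) hP (M.policyReward π)
  refine tendsto_nhds_limUnder ⟨z s, ?_⟩
  have := (tendsto_pi_nhds.1 hz) s
  simpa [MDP.expReward, Finset.sum_apply] using this

/-- A deterministic stationary policy seen as a randomized one. -/
def detPolicy [DecidableEq A] (π : S → A) : S → A → ℝ :=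
  fun s => Pi.single (π s) 1

/-- The optimal gain: the best gain over all stationary (randomized) policies and all initial
states.  Whenever some policy maximizes the gain in every state and has a constant gain, as in any
weakly communicating MDP, this is the gain of that policy. -/
def MDP.optGain (M : MDP S A) : ℝ :=
  ⨆ x : (S → stdSimplex ℝ A) × S, M.gain (fun s => (x.1 s : A → ℝ)) x.2

end Gain

/-! ### Data collection -/

/-- A record of data: at step `t` the pair `(state t, action t)` is sampled, and the reward
`reward t` and the next state `next t` are observed.  Steps are numbered from `0`. -/
structure Trajectory (S A : Type*) where
  state : ℕ → S
  action : ℕ → A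
  reward : ℕ → ℝ
  next : ℕ → S

/-- The two models of data collection. -/
inductive Model
  | generative
  | online

/-- `X` is the random data collected in the MDP `M` by some sampling rule.  The σ-algebra `ℱ t` is
the information available before the `t`-th observation (past observations, and any
internal randomization of the rule), and the pair sampled at step `t` is an arbitrary `ℱ t`
measurable choice.  Given `ℱ t`, the next state has law `p_{s_t,a_t}` and the reward has law
`r(s_t,a_t)`.  In the online model, the state of step `t + 1` is the next state observed at
step `t`. -/
structure IsRun (M : MDP S A) (model : Model) {Ω : Type*} [mΩ : MeasurableSpace Ω]
    (μ : Measure Ω) (ℱ : Filtration ℕ mΩ) (X : Ω → Trajectory S A) : Prop where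
  state_adapted : ∀ t s, MeasurableSet[ℱ t] {ω | (X ω).state t = s}
  action_adapted : ∀ t a, MeasurableSet[ℱ t] {ω | (X ω).action t = a}
  next_adapted : ∀ t s, MeasurableSet[ℱ (t + 1)] {ω | (X ω).next t = s}
  reward_adapted : ∀ t, Measurable[ℱ (t + 1)] fun ω => (X ω).reward t
  next_law : ∀ t s',
    μ[Set.indicator {ω | (X ω).next t = s'} (fun _ => (1 : ℝ)) | ℱ t]
      =ᵐ[μ] fun ω => M.p ((X ω).state t) ((X ω).action t) s'
  reward_law : ∀ t (B : Set ℝ), MeasurableSet B →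
    μ[Set.indicator {ω | (X ω).reward t ∈ B} (fun _ => (1 : ℝ)) | ℱ t]
      =ᵐ[μ] fun ω => (M.rew ((X ω).state t) ((X ω).action t)).real B
  online_state : model = Model.online → ∀ t, ∀ᵐ ω ∂μ, (X ω).state (t + 1) = (X ω).next t

/-! ### The Value Iteration stopping rule -/

section Rule

variable [DecidableEq S] [DecidableEq A]

/-- Number of visits to `(s, a)` in the first `n` steps. -/
def Trajectory.visits (x : Trajectory S A) (n : ℕ) (s : S) (a : A) : ℕ :=
  ((Finset.range n).filter fun t => x.state t = s ∧ x.action t = a).card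

/-- Empirical transition probabilities after `n` steps, uniform if `(s, a)` was never sampled. -/
def Trajectory.phat (x : Trajectory S A) (n : ℕ) (s : S) (a : A) (s' : S) : ℝ :=
  if x.visits n s a = 0 then 1 / (Fintype.card S : ℝ)
  else (((Finset.range n).filter
      fun t => x.state t = s ∧ x.action t = a ∧ x.next t = s').card : ℝ) / (x.visits n s a : ℝ)

/-- Kullback-Leibler divergence of probability vectors, infinite when `p` is not absolutely
continuous with respect to `q`. -/
def kl (p q : S → ℝ) : EReal :=
  open Classical in
  if ∀ s, q s = 0 → p s = 0 then ((∑ s, p s * Real.log (p s / q s) : ℝ) : EReal) else ⊤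

variable [Fintype A]

variable (S A) in
/-- The threshold `x(δ,y) = log(SA/δ) + (S-1) log(e(1+y/(S-1)))`; the second term is `0` if there is
only one state. -/
def threshold (δ y : ℝ) : ℝ :=
  Real.log ((Fintype.card S : ℝ) * (Fintype.card A : ℝ) / δ)
    + ((Fintype.card S : ℝ) - 1)
      * Real.log (Real.exp 1 * (1 + y / ((Fintype.card S : ℝ) - 1)))

/-- The probability vectors `q` such that `N KL(phat, q) ≤ x(δ, N)`, where `N` is the number of
visits to `(s, a)`; all probability vectors if `N = 0` (in `EReal`, `0 * ⊤ = 0`). -/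
def Trajectory.confSet (x : Trajectory S A) (δ : ℝ) (n : ℕ) (s : S) (a : A) : Set (S → ℝ) :=
  {q | q ∈ stdSimplex ℝ S ∧
    ((x.visits n s a : ℝ) : EReal) * kl (x.phat n s a) q
      ≤ ((threshold S A δ (x.visits n s a) : ℝ) : EReal)}

/-- The upper confidence bound `U^n_{s,a}(b; δ)`. -/
def Trajectory.upper (x : Trajectory S A) (δ : ℝ) (n : ℕ) (b : S → ℝ) (s : S) (a : A) : ℝ :=
  sSup ((fun q : S → ℝ => ∑ s', q s' * b s') '' x.confSet δ n s a)

/-- The lower confidence bound `L^n_{s,a}(b; δ)`. -/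
def Trajectory.lower (x : Trajectory S A) (δ : ℝ) (n : ℕ) (b : S → ℝ) (s : S) (a : A) : ℝ :=
  sInf ((fun q : S → ℝ => ∑ s', q s' * b s') '' x.confSet δ n s a)

/-- `I^{n,♯}_{s,a}(b; δ)`. -/
def MDP.Isharp (M : MDP S A) (x : Trajectory S A) (δ : ℝ) (n : ℕ) (b : S → ℝ) (s : S) (a : A) :
    ℝ :=
  M.rbar s a + x.upper δ n b s a - b s

/-- `I^{n,♭}_{s,a}(b; δ)`. -/
def MDP.Iflat (M : MDP S A) (x : Trajectory S A) (δ : ℝ) (n : ℕ) (b : S → ℝ) (s : S) (a : A) :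
    ℝ :=
  M.rbar s a + x.lower δ n b s a - b s

/-- The stopping time `τ_{ε,δ}` for the sequence of bias vectors `b`: the first `n` at which
`max_s max_a I^♯ - min_s max_a I^♭ ≤ ε`, and `⊤` if there is none. -/
def MDP.tau (M : MDP S A) (x : Trajectory S A) (b : ℕ → S → ℝ) (ε δ : ℝ) : ℕ∞ :=
  sInf {k : ℕ∞ | ∃ n : ℕ, k = n ∧
    (⨆ s, ⨆ a, M.Isharp x δ n (b n) s a) - (⨅ s, ⨆ a, M.Iflat x δ n (b n) s a) ≤ ε}

/-- `π` is a policy recommended at time `n`: `π s` belongs to `argmax_a I^{n,♭}_{s,a}(b; δ)`. -/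
def MDP.IsRecommended (M : MDP S A) (x : Trajectory S A) (δ : ℝ) (n : ℕ) (b : S → ℝ)
    (π : S → A) : Prop :=
  ∀ s a, M.Iflat x δ n b s a ≤ M.Iflat x δ n b s (π s)

end Rule

end AvgRewardMDP

end

namespace AvgRewardMDP

/-! ### Gain bounds from one-step inequalities -/

section GainBounds

variable {S A : Type*} [Fintype S] [Fintype A]

/-! The proof separates a deterministic statement from a time-uniform probability bound.

Deterministic part. If one step of the Bellman operator raises some vector b by at most c at every
state-action pair, iterating along a policy telescopes to a total reward of at most T c + 2‖b‖, so
every gain is at most c (`MDP.gain_le`). The reverse inequality at the chosen actions bounds a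
policy's gain from below (`MDP.le_gain_detPolicy`). If all true vectors p lie in their confidence
sets, the maximum of I^♯ therefore bounds the optimal gain from above, and the min-max of I^♭ bounds
the gain of the recommended policy from below. This holds for every b at once, so b may depend on
the data.

Probabilistic part. For a pair (s,a), let W be the product over its visits of the add-one (Laplace)
estimate of the observed transition divided by its true probability. Each factor has conditional
mean at most 1, so Ville's inequality keeps W below SA/δ at all times, except with probability
δ/(SA) (`measure_exists_le_prod_le`). With m = S - 1 and counts k summing to N, W depends only on k:
it is the reciprocal of binom(N+m, m) · multinomial(k) · ∏ p_i^{k_i} (`MDP.prod_laplaceRatio`). As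
multinomial(k) · ∏ (k_i/N)^{k_i} ≤ 1, it follows that exp(N KL) ≤ W · binom(N+m, m)
(`exp_sum_mul_log_le`). The bound binom(N+m, m) ≤ (e(1+N/m))^m then produces exactly the threshold
x(δ,N). A union bound over the SA pairs gives δ; since the coverage holds for all n simultaneously,
the random time τ needs no further argument. -/

theorem MDP.policyMatrix_mem (M : MDP S A) {π : S → A → ℝ} (hπ : ∀ s, π s ∈ stdSimplex ℝ A)
    (s : S) : M.policyMatrix π s ∈ stdSimplex ℝ S := by
  refine ⟨fun s' => Finset.sum_nonneg fun a _ =>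
    mul_nonneg ((hπ s).1 a) ((M.p_mem s a).1 s'), ?_⟩
  simp only [MDP.policyMatrix, Matrix.of_apply]
  rw [Finset.sum_comm]
  simp only [← Finset.mul_sum, (M.p_mem s _).2, mul_one, (hπ s).2]

theorem mulVec_le_of_le (P : Matrix S S ℝ) (hP : ∀ s, P s ∈ stdSimplex ℝ S) {v : S → ℝ} {c : ℝ}
    (hv : ∀ s, v s ≤ c) (s : S) : P.mulVec v s ≤ c := by
  calc P.mulVec v s = ∑ s', P s s' * v s' := rfl
    _ ≤ ∑ s', P s s' * c :=
        Finset.sum_le_sum fun s' _ => mul_le_mul_of_nonneg_left (hv s') ((hP s).1 s')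
    _ = c := by rw [← Finset.sum_mul, (hP s).2, one_mul]

theorem MDP.policy_bellman (M : MDP S A) {π : S → A → ℝ} (hπ : ∀ s, π s ∈ stdSimplex ℝ A)
    (b : S → ℝ) (s : S) :
    M.policyReward π s + (M.policyMatrix π).mulVec b s - b s =
      ∑ a, π s a * (M.rbar s a + ∑ s', M.p s a s' * b s' - b s) := by
  have h1 : (M.policyMatrix π).mulVec b s = ∑ a, π s a * ∑ s', M.p s a s' * b s' := by
    simp only [Matrix.mulVec, dotProduct, MDP.policyMatrix, Matrix.of_apply, Finset.sum_mul,
      Finset.mul_sum]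
    rw [Finset.sum_comm]
    simp only [mul_assoc]
  simp only [mul_sub, mul_add, Finset.sum_sub_distrib, Finset.sum_add_distrib, h1,
    ← Finset.sum_mul, (hπ s).2, one_mul, MDP.policyReward]

variable [DecidableEq S]

theorem pow_mulVec_le_of_le (P : Matrix S S ℝ) (hP : ∀ s, P s ∈ stdSimplex ℝ S) {v : S → ℝ}
    {c : ℝ} (hv : ∀ s, v s ≤ c) (n : ℕ) (s : S) : (P ^ n).mulVec v s ≤ c := by
  induction n generalizing s with
  | zero => simpa using hv s
  | succ n ih =>
    rw [pow_succ', ← Matrix.mulVec_mulVec]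
    exact mulVec_le_of_le P hP ih s

/-- If `r + P b - b ≤ c` coordinatewise, the Cesàro limit of `P ^ t r` is at most `c`. -/
theorem cesaro_limit_le (P : Matrix S S ℝ) (hP : ∀ s, P s ∈ stdSimplex ℝ S) (r b : S → ℝ)
    {c g : ℝ} (h : ∀ s, r s + P.mulVec b s - b s ≤ c) (s : S)
    (hg : Tendsto (fun T : ℕ => (T : ℝ)⁻¹ * ∑ t ∈ Finset.range T, (P ^ t).mulVec r s) atTop
      (𝓝 g)) : g ≤ c := by
  have hb : ∀ T : ℕ, ∑ t ∈ Finset.range T, (P ^ t).mulVec r s ≤ T * c + 2 * ‖b‖ := by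
    intro T
    -- Apply P ^ t to r + P b - b ≤ c; the b terms telescope when summed over t.
    have h1 : ∀ t, (P ^ t).mulVec r s ≤
        c + ((P ^ t).mulVec b s - (P ^ (t + 1)).mulVec b s) := by
      intro t
      have := pow_mulVec_le_of_le P hP (v := r + P.mulVec b - b) (c := c) h t s
      rw [Matrix.mulVec_sub, Matrix.mulVec_add, Matrix.mulVec_mulVec, ← pow_succ] at this
      simp only [Pi.add_apply, Pi.sub_apply] at this
      linarith
    calc ∑ t ∈ Finset.range T, (P ^ t).mulVec r s
        ≤ ∑ t ∈ Finset.range T, (c + ((P ^ t).mulVec b s - (P ^ (t + 1)).mulVec b s)) :=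
          Finset.sum_le_sum fun t _ => h1 t
      _ = T * c + (b s - (P ^ T).mulVec b s) := by
          rw [Finset.sum_add_distrib, Finset.sum_range_sub']
          simp
      _ ≤ T * c + 2 * ‖b‖ := by
          have h2 := (abs_le.1 (norm_le_pi_norm b s)).2
          have h3 := (abs_le.1 ((norm_le_pi_norm ((P ^ T).mulVec b) s).trans
            (norm_pow_mulVec_le P hP b T))).1
          linarith
  have hlim : Tendsto (fun T : ℕ => c + (T : ℝ)⁻¹ * (2 * ‖b‖)) atTop (𝓝 c) := by
    simpa using tendsto_const_nhds.add
      ((tendsto_inv_atTop_nhds_zero_nat (𝕜 := ℝ)).mul_const (2 * ‖b‖))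
  refine le_of_tendsto_of_tendsto hg hlim ?_
  filter_upwards [eventually_gt_atTop 0] with T hT
  have hT' : (T : ℝ) ≠ 0 := by positivity
  calc (T : ℝ)⁻¹ * ∑ t ∈ Finset.range T, (P ^ t).mulVec r s
      ≤ (T : ℝ)⁻¹ * (T * c + 2 * ‖b‖) := mul_le_mul_of_nonneg_left (hb T) (by positivity)
    _ = c + (T : ℝ)⁻¹ * (2 * ‖b‖) := by field_simp

/-- Changing the signs of r, b, c and g turns this into the upper bound. -/
theorem le_cesaro_limit (P : Matrix S S ℝ) (hP : ∀ s, P s ∈ stdSimplex ℝ S) (r b : S → ℝ)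
    {c g : ℝ} (h : ∀ s, c ≤ r s + P.mulVec b s - b s) (s : S)
    (hg : Tendsto (fun T : ℕ => (T : ℝ)⁻¹ * ∑ t ∈ Finset.range T, (P ^ t).mulVec r s) atTop
      (𝓝 g)) : c ≤ g := by
  have := cesaro_limit_le P hP (-r) (-b) (c := -c) (g := -g)
    (fun s => by simp only [Matrix.mulVec_neg, Pi.neg_apply]; linarith [h s]) s
    (by simpa [Matrix.mulVec_neg] using hg.neg)
  linarith

/-- The gain of a policy is at most `c` if the one-step Bellman operator increases some bias vector
by at most `c`. -/
theorem MDP.gain_le (M : MDP S A) {π : S → A → ℝ} (hπ : ∀ s, π s ∈ stdSimplex ℝ A) (b : S → ℝ)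
    {c : ℝ} (h : ∀ s a, M.rbar s a + ∑ s', M.p s a s' * b s' - b s ≤ c) (s : S) :
    M.gain π s ≤ c := by
  refine cesaro_limit_le (M.policyMatrix π) (M.policyMatrix_mem hπ) (M.policyReward π) b
    (fun s => ?_) s (M.tendsto_gain π hπ s)
  rw [M.policy_bellman hπ]
  calc _ ≤ ∑ a, π s a * c :=
        Finset.sum_le_sum fun a _ => mul_le_mul_of_nonneg_left (h s a) ((hπ s).1 a)
    _ = c := by rw [← Finset.sum_mul, (hπ s).2, one_mul]

theorem MDP.le_gain_detPolicy [DecidableEq A] (M : MDP S A) (π : S → A) (b : S → ℝ) {c : ℝ}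
    (h : ∀ s, c ≤ M.rbar s (π s) + ∑ s', M.p s (π s) s' * b s' - b s) (s : S) :
    c ≤ M.gain (detPolicy π) s := by
  have hπ : ∀ s, detPolicy π s ∈ stdSimplex ℝ A := fun s => single_mem_stdSimplex ℝ (π s)
  refine le_cesaro_limit (M.policyMatrix (detPolicy π)) (M.policyMatrix_mem hπ)
    (M.policyReward (detPolicy π)) b (fun s => ?_) s (M.tendsto_gain _ hπ s)
  rw [M.policy_bellman hπ]
  simpa [detPolicy, Pi.single_apply] using h s

theorem MDP.optGain_le [Nonempty S] [Nonempty A] (M : MDP S A) (b : S → ℝ) {c : ℝ}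
    (h : ∀ s a, M.rbar s a + ∑ s', M.p s a s' * b s' - b s ≤ c) : M.optGain ≤ c := by
  classical
  -- `ciSup_le` needs a nonempty index type, a real supremum over an empty family being 0 by
  -- convention.
  have : Nonempty (stdSimplex ℝ A) :=
    ⟨⟨_, single_mem_stdSimplex ℝ (Classical.arbitrary A)⟩⟩
  exact ciSup_le fun x => M.gain_le (fun s => (x.1 s).2) b h x.2

end GainBounds

/-! ### Correctness of the stopping rule when the confidence sets contain the truth -/

section Correctness

variable {S A : Type*} [Fintype S]

theorem abs_sum_mul_le_of_mem_stdSimplex {q : S → ℝ} (hq : q ∈ stdSimplex ℝ S) (b : S → ℝ) :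
    |∑ s, q s * b s| ≤ ‖b‖ := by
  calc |∑ s, q s * b s| ≤ ∑ s, |q s * b s| := Finset.abs_sum_le_sum_abs _ _
    _ ≤ ∑ s, q s * ‖b‖ := by
        refine Finset.sum_le_sum fun s _ => ?_
        rw [abs_mul, abs_of_nonneg (hq.1 s)]
        exact mul_le_mul_of_nonneg_left (norm_le_pi_norm b s) (hq.1 s)
    _ = ‖b‖ := by rw [← Finset.sum_mul, hq.2, one_mul]

variable [Fintype A] [DecidableEq S] [DecidableEq A]

theorem Trajectory.le_upper (x : Trajectory S A) {δ : ℝ} {n : ℕ} {s : S} {a : A} {q : S → ℝ}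
    (hq : q ∈ x.confSet δ n s a) (b : S → ℝ) : ∑ s', q s' * b s' ≤ x.upper δ n b s a := by
  -- Probability vectors average b to a value in [-‖b‖, ‖b‖], which bounds the set; attainment of
  -- the supremum is never needed.
  refine le_csSup ⟨‖b‖, ?_⟩ ⟨q, hq, rfl⟩
  rintro _ ⟨q', hq', rfl⟩
  exact (abs_le.1 (abs_sum_mul_le_of_mem_stdSimplex hq'.1 b)).2

theorem Trajectory.lower_le (x : Trajectory S A) {δ : ℝ} {n : ℕ} {s : S} {a : A} {q : S → ℝ}
    (hq : q ∈ x.confSet δ n s a) (b : S → ℝ) : x.lower δ n b s a ≤ ∑ s', q s' * b s' := by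
  refine csInf_le ⟨-‖b‖, ?_⟩ ⟨q, hq, rfl⟩
  rintro _ ⟨q', hq', rfl⟩
  exact (abs_le.1 (abs_sum_mul_le_of_mem_stdSimplex hq'.1 b)).1

/-- When the stopping condition holds at time `n` and the confidence sets contain the transition
vectors, a recommended policy is `ε`-optimal from every state. -/
theorem MDP.optGain_sub_gain_le [Nonempty S] [Nonempty A] (M : MDP S A) (x : Trajectory S A)
    {ε δ : ℝ} {n : ℕ} {b : S → ℝ} (hconf : ∀ s a, M.p s a ∈ x.confSet δ n s a)
    (hgap : (⨆ s, ⨆ a, M.Isharp x δ n b s a) - (⨅ s, ⨆ a, M.Iflat x δ n b s a) ≤ ε)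
    {π : S → A} (hπ : M.IsRecommended x δ n b π) (s : S) :
    M.optGain - M.gain (detPolicy π) s ≤ ε := by
  have h1 : M.optGain ≤ ⨆ s, ⨆ a, M.Isharp x δ n b s a := by
    refine M.optGain_le b fun s a => ?_
    calc M.rbar s a + ∑ s', M.p s a s' * b s' - b s ≤ M.Isharp x δ n b s a := by
          have := x.le_upper (hconf s a) b
          unfold MDP.Isharp
          linarith
      _ ≤ ⨆ a, M.Isharp x δ n b s a := le_ciSup (Set.finite_range _).bddAbove a
      _ ≤ _ := le_ciSup (f := fun s => ⨆ a, M.Isharp x δ n b s a)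
          (Set.finite_range _).bddAbove s
  have h2 : (⨅ s, ⨆ a, M.Iflat x δ n b s a) ≤ M.gain (detPolicy π) s := by
    refine M.le_gain_detPolicy π b (fun s => ?_) s
    calc (⨅ s, ⨆ a, M.Iflat x δ n b s a) ≤ ⨆ a, M.Iflat x δ n b s a :=
          ciInf_le (Set.finite_range _).bddBelow s
      _ ≤ M.Iflat x δ n b s (π s) := ciSup_le (hπ s)
      _ ≤ _ := by
          have := x.lower_le (hconf s (π s)) b
          unfold MDP.Iflat
          linarith
  linarith

/-- If the stopping time is finite, the stopping condition holds at that time. -/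
theorem MDP.exists_tau_eq (M : MDP S A) (x : Trajectory S A) (b : ℕ → S → ℝ) (ε δ : ℝ)
    (h : M.tau x b ε δ < ⊤) : ∃ n : ℕ, M.tau x b ε δ = n ∧
      (⨆ s, ⨆ a, M.Isharp x δ n (b n) s a) - (⨅ s, ⨆ a, M.Iflat x δ n (b n) s a) ≤ ε := by
  -- ℕ∞ is well ordered, so a nonempty set attains its infimum; the empty set would give ⊤.
  refine csInf_mem (s := {k : ℕ∞ | ∃ n : ℕ, k = n ∧ _}) ?_
  by_contra hne
  rw [Set.not_nonempty_iff_eq_empty] at hne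
  rw [MDP.tau, hne, sInf_empty] at h
  exact lt_irrefl _ h

end Correctness

end AvgRewardMDP

namespace AvgRewardMDP

/-! ### The Laplace estimator and the method of types -/

/-- Combines binom(N+m, m) ≤ (N+m)^m / m! with m^m / m! ≤ e^m. For m = 0 both sides are 1, whatever
N / 0 is. -/
theorem choose_add_le_exp (N m : ℕ) :
    ((N + m).choose m : ℝ) ≤ Real.exp (m * Real.log (Real.exp 1 * (1 + N / m))) := by
  rcases Nat.eq_zero_or_pos m with rfl | hm
  · simp
  have hm' : (0 : ℝ) < m := by exact_mod_cast hm
  have hpos : 0 < Real.exp 1 * (1 + (N : ℝ) / m) := by positivity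
  rw [mul_comm, Real.exp_mul, Real.exp_log hpos, Real.rpow_natCast]
  have h1 : ((N + m).choose m : ℝ) ≤ ((N + m : ℕ) : ℝ) ^ m / (m.factorial : ℝ) :=
    Nat.choose_le_pow_div m (N + m)
  have h2 : (m : ℝ) ^ m / (m.factorial : ℝ) ≤ Real.exp m :=
    Real.pow_div_factorial_le_exp _ hm'.le m
  calc ((N + m).choose m : ℝ) ≤ ((N + m : ℕ) : ℝ) ^ m / (m.factorial : ℝ) := h1
    _ = (1 + (N : ℝ) / m) ^ m * ((m : ℝ) ^ m / (m.factorial : ℝ)) := by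
        rw [← mul_div_assoc, ← mul_pow]
        congr 2
        push_cast
        field_simp
        ring
    _ ≤ (1 + (N : ℝ) / m) ^ m * Real.exp m := by gcongr
    _ = (Real.exp 1 * (1 + (N : ℝ) / m)) ^ m := by
        rw [mul_pow, ← Real.exp_nat_mul, mul_one, mul_comm]

section MethodOfTypes

variable {S : Type*} [Fintype S]

/-- The left side is one term of the multinomial expansion of (∑ k_i / N)^N = 1, all of whose terms
are nonnegative. -/
theorem multinomial_mul_prod_le_one (k : S → ℕ) :
    (Nat.multinomial Finset.univ k : ℝ) * ∏ i, ((k i : ℝ) / (∑ j, k j : ℕ)) ^ k i ≤ 1 := by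
  classical
  set N := ∑ j, k j with hN
  have h1 : (∑ i, (k i : ℝ) / N) ^ N = 1 := by
    rcases Nat.eq_zero_or_pos N with h | h
    · simp [h]
    · have : (N : ℝ) ≠ 0 := by positivity
      rw [← Finset.sum_div, ← Nat.cast_sum, ← hN, div_self this, one_pow]
  rw [← h1, Finset.sum_pow_eq_sum_piAntidiag]
  refine Finset.single_le_sum
    (f := fun k' : S → ℕ => (Nat.multinomial Finset.univ k' : ℝ) * ∏ i, ((k i : ℝ) / N) ^ k' i)
    (fun k' _ => by positivity) ?_
  simp [Finset.mem_piAntidiag, hN]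

/-- If the weight `W` equals the Laplace mixture likelihood of a sample with counts `k` divided by
its likelihood under `p`, then `exp (N KL(k / N, p))` exceeds `W` at most by the number of types. -/
theorem exp_sum_mul_log_le (k : S → ℕ) {p : S → ℝ} (hp : ∀ i, 0 ≤ p i)
    (hk : ∀ i, p i = 0 → k i = 0) {m : ℕ} {W : ℝ}
    (hW : W * ((∏ i, p i ^ k i) * ((∑ i, k i) + m).factorial) =
      m.factorial * ∏ i, ((k i).factorial : ℝ)) :
    Real.exp (∑ i, k i * Real.log ((k i : ℝ) / (∑ j, k j : ℕ) / p i)) ≤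
      W * (((∑ i, k i) + m).choose m : ℝ) := by
  set N := ∑ j, k j with hN
  set E := Real.exp (∑ i, k i * Real.log ((k i : ℝ) / N / p i)) with hE
  set P := ∏ i, p i ^ k i with hP
  have hPpos : 0 < P := by
    refine Finset.prod_pos fun i _ => ?_
    rcases Nat.eq_zero_or_pos (k i) with h | h
    · simp [h]
    · exact pow_pos ((hp i).lt_of_ne fun h0 => h.ne' (hk i h0.symm)) _
  have hEP : E * P = ∏ i, ((k i : ℝ) / N) ^ k i := by
    rw [hE, hP, Real.exp_sum, ← Finset.prod_mul_distrib]
    refine Finset.prod_congr rfl fun i _ => ?_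
    rcases Nat.eq_zero_or_pos (k i) with h | h
    · simp [h]
    · have hpi : 0 < p i := (hp i).lt_of_ne fun h0 => h.ne' (hk i h0.symm)
      have hNpos : 0 < N := h.trans_le (Finset.single_le_sum (f := k) (fun _ _ => Nat.zero_le _)
        (Finset.mem_univ i))
      have hpos : 0 < (k i : ℝ) / N / p i := by positivity
      rw [Real.exp_nat_mul, Real.exp_log hpos, ← mul_pow, div_mul_cancel₀ _ hpi.ne']
  have hmult : (Nat.multinomial Finset.univ k : ℝ) * (E * P) ≤ 1 := by
    rw [hEP]
    exact multinomial_mul_prod_le_one k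
  have hmpos : (0 : ℝ) < Nat.multinomial Finset.univ k := by
    exact_mod_cast Nat.multinomial_pos _ _
  have hspec : (∏ i, ((k i).factorial : ℝ)) * Nat.multinomial Finset.univ k = N.factorial := by
    exact_mod_cast Nat.multinomial_spec Finset.univ k
  have hchoose : ((N + m).choose m : ℝ) * N.factorial * m.factorial = (N + m).factorial := by
    have := Nat.add_choose_mul_factorial_mul_factorial N m
    exact_mod_cast this
  have hfac : (0 : ℝ) < m.factorial * ∏ i, ((k i).factorial : ℝ) := by positivity
  -- Rewriting the factorials in `hW` shows that W · binom(N+m, m) is the reciprocal of Q =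
  -- multinomial(k) · P. Since E · Q ≤ 1 by `hmult`, cancelling Q finishes the proof.
  have hone : W * ((N + m).choose m : ℝ) * (Nat.multinomial Finset.univ k * P) = 1 := by
    refine mul_right_cancel₀ hfac.ne' ?_
    calc W * ((N + m).choose m : ℝ) * (Nat.multinomial Finset.univ k * P) *
          (m.factorial * ∏ i, ((k i).factorial : ℝ))
        = W * (P * (((N + m).choose m : ℝ) *
            ((∏ i, ((k i).factorial : ℝ)) * Nat.multinomial Finset.univ k) * m.factorial)) := by
          ring
      _ = 1 * (m.factorial * ∏ i, ((k i).factorial : ℝ)) := by rw [hspec, hchoose, hW, one_mul]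
  have hQ : 0 < (Nat.multinomial Finset.univ k : ℝ) * P := mul_pos hmpos hPpos
  refine le_of_mul_le_mul_right ?_ hQ
  rw [hone]
  linarith

end MethodOfTypes

/-- Needed for unvisited pairs, whose confidence set has to be the whole simplex. -/
theorem threshold_nonneg {S A : Type*} [Fintype S] [Fintype A] [Nonempty S] [Nonempty A]
    {δ : ℝ} (hδ : 0 < δ) (hδ1 : δ ≤ 1) :
    0 ≤ threshold S A δ 0 := by
  have hS : (1 : ℝ) ≤ Fintype.card S := by exact_mod_cast Fintype.card_pos (α := S)
  have hA : (1 : ℝ) ≤ Fintype.card A := by exact_mod_cast Fintype.card_pos (α := A)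
  have h1 : 0 ≤ Real.log ((Fintype.card S : ℝ) * Fintype.card A / δ) := by
    refine Real.log_nonneg ?_
    rw [le_div_iff₀ hδ]
    nlinarith
  simp only [threshold, zero_div, add_zero, mul_one, Real.log_exp]
  linarith

section LaplaceWeight

variable {S A : Type*} [DecidableEq S] [DecidableEq A]

/-- Number of transitions from `(s, a)` to `s'` observed in the first `n` steps. -/
def Trajectory.transitions (x : Trajectory S A) (n : ℕ) (s : S) (a : A) (s' : S) : ℕ :=
  ((Finset.range n).filter fun t => x.state t = s ∧ x.action t = a ∧ x.next t = s').card

theorem Trajectory.visits_succ (x : Trajectory S A) (n : ℕ) (s : S) (a : A) :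
    x.visits (n + 1) s a = x.visits n s a + if x.state n = s ∧ x.action n = a then 1 else 0 := by
  simp only [Trajectory.visits, Finset.card_filter, Finset.sum_range_succ]

theorem Trajectory.transitions_succ (x : Trajectory S A) (n : ℕ) (s : S) (a : A) (i : S) :
    x.transitions (n + 1) s a i = x.transitions n s a i +
      if x.state n = s ∧ x.action n = a ∧ x.next n = i then 1 else 0 := by
  simp only [Trajectory.transitions, Finset.card_filter, Finset.sum_range_succ]

theorem Trajectory.transitions_eq_zero (x : Trajectory S A) {n : ℕ} {s : S} {a : A} {i : S}
    (h : ∀ t, x.state t = s → x.action t = a → x.next t ≠ i) : x.transitions n s a i = 0 := by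
  rw [Trajectory.transitions, Finset.card_eq_zero, Finset.filter_eq_empty_iff]
  rintro t - ⟨h1, h2, h3⟩
  exact h t h1 h2 h3

variable [Fintype S]

theorem Trajectory.sum_transitions (x : Trajectory S A) (n : ℕ) (s : S) (a : A) :
    ∑ i, x.transitions n s a i = x.visits n s a := by
  induction n with
  | zero => simp [Trajectory.transitions, Trajectory.visits]
  | succ n ih =>
    simp only [Trajectory.transitions_succ, Trajectory.visits_succ, Finset.sum_add_distrib, ih]
    by_cases h : x.state n = s ∧ x.action n = a <;> simp [← and_assoc, h]

/-- The likelihood ratio, at step `t`, of the Laplace estimator of the transitions from `(s, a)`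
and of the true transition vector, for an observed next state `i`. -/
noncomputable def MDP.laplaceRatio (M : MDP S A) (x : Trajectory S A) (s : S) (a : A) (t : ℕ)
    (i : S) : ℝ :=
  if x.state t = s ∧ x.action t = a then
    ((x.transitions t s a i + 1 : ℝ) / (x.visits t s a + Fintype.card S)) / M.p s a i
  else 1

/-- The product of the likelihood ratios is the Laplace mixture likelihood of the counts divided
by their likelihood under the true transition vector. -/
theorem MDP.prod_laplaceRatio (M : MDP S A) (x : Trajectory S A) {m : ℕ}
    (hm : Fintype.card S = m + 1) {s : S} {a : A}
    (h : ∀ t, x.state t = s → x.action t = a → M.p s a (x.next t) ≠ 0) (n : ℕ) :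
    (∏ t ∈ Finset.range n, M.laplaceRatio x s a t (x.next t)) *
      ((∏ i, M.p s a i ^ x.transitions n s a i) * ((∑ i, x.transitions n s a i) + m).factorial) =
      m.factorial * ∏ i, ((x.transitions n s a i).factorial : ℝ) := by
  rw [x.sum_transitions]
  induction n with
  | zero => simp [Trajectory.transitions, Trajectory.visits]
  | succ n ih =>
    rw [Finset.prod_range_succ]
    -- Observing j from (s,a) multiplies the likelihood by p_j, the product of factorials by k_j +
    -- 1, and (N+m)! by N + m + 1 = N + S: these are the three ingredients of the ratio.
    by_cases hc : x.state n = s ∧ x.action n = a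
    · have hv : x.visits (n + 1) s a = x.visits n s a + 1 := by rw [x.visits_succ, if_pos hc]
      have ht : ∀ i, x.transitions (n + 1) s a i =
          x.transitions n s a i + if x.next n = i then 1 else 0 := by
        intro i
        rw [x.transitions_succ]
        simp [hc.1, hc.2]
      have hp := h n hc.1 hc.2
      have h1 : ∏ i, M.p s a i ^ x.transitions (n + 1) s a i =
          (∏ i, M.p s a i ^ x.transitions n s a i) * M.p s a (x.next n) := by
        simp only [ht, pow_add, Finset.prod_mul_distrib, pow_ite, pow_one, pow_zero,
          Finset.prod_ite_eq, Finset.mem_univ, if_true]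
      have h2 : ∏ i, ((x.transitions (n + 1) s a i).factorial : ℝ) =
          (∏ i, ((x.transitions n s a i).factorial : ℝ)) *
            (x.transitions n s a (x.next n) + 1) := by
        have : ∀ i, ((x.transitions (n + 1) s a i).factorial : ℝ) =
            (x.transitions n s a i).factorial *
              if x.next n = i then (x.transitions n s a i + 1 : ℝ) else 1 := by
          intro i
          rw [ht]
          split_ifs
          · rw [Nat.factorial_succ]
            push_cast
            ring
          · simp
        simp only [this, Finset.prod_mul_distrib, Finset.prod_ite_eq, Finset.mem_univ, if_true]
      have h3 : ((x.visits (n + 1) s a + m).factorial : ℝ) =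
          (x.visits n s a + Fintype.card S) * (x.visits n s a + m).factorial := by
        rw [hv, add_right_comm, Nat.factorial_succ, hm]
        push_cast
        ring
      have hpos : (x.visits n s a + Fintype.card S : ℝ) ≠ 0 := by
        rw [hm]
        positivity
      rw [h1, h2, h3, MDP.laplaceRatio, if_pos hc, ← mul_assoc (m.factorial : ℝ), ← ih]
      field_simp
    · have hv : x.visits (n + 1) s a = x.visits n s a := by
        rw [x.visits_succ, if_neg hc, add_zero]
      have ht : ∀ i, x.transitions (n + 1) s a i = x.transitions n s a i := by
        intro i
        rw [x.transitions_succ, if_neg (fun h => hc ⟨h.1, h.2.1⟩), add_zero]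
      simp only [hv, ht, MDP.laplaceRatio, if_neg hc, mul_one]
      exact ih

variable [Fintype A]

/-- The true transition vector lies in the confidence set as long as the Laplace weight is below
its level. -/
theorem MDP.p_mem_confSet [Nonempty S] [Nonempty A] (M : MDP S A) (x : Trajectory S A) {δ : ℝ}
    (hδ : 0 < δ) (hδ1 : δ ≤ 1) {s : S} {a : A}
    (h : ∀ t, x.state t = s → x.action t = a → M.p s a (x.next t) ≠ 0) {n : ℕ}
    (hW : ∏ t ∈ Finset.range n, M.laplaceRatio x s a t (x.next t) <
      Fintype.card S * Fintype.card A / δ) :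
    M.p s a ∈ x.confSet δ n s a := by
  refine ⟨M.p_mem s a, ?_⟩
  set N := x.visits n s a with hN
  -- Without visits the empirical vector is uniform and its divergence may be ⊤; the convention 0 *
  -- ⊤ = 0 settles this case.
  rcases Nat.eq_zero_or_pos N with h0 | hNpos
  · rw [h0]
    have : ((0 : ℕ) : ℝ) = 0 := Nat.cast_zero
    rw [this, EReal.coe_zero, zero_mul]
    exact_mod_cast threshold_nonneg hδ hδ1
  obtain ⟨m, hm⟩ : ∃ m, Fintype.card S = m + 1 :=
    ⟨Fintype.card S - 1, (Nat.sub_add_cancel Fintype.card_pos).symm⟩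
  have hcm : (Fintype.card S : ℝ) - 1 = m := by
    rw [hm]
    push_cast
    ring
  have hSA : (0 : ℝ) < Fintype.card S * Fintype.card A / δ := by
    have : (0 : ℝ) < Fintype.card A := by exact_mod_cast Fintype.card_pos (α := A)
    rw [hm]
    positivity
  have hphat : ∀ i, x.phat n s a i = (x.transitions n s a i : ℝ) / N := fun i =>
    if_neg hNpos.ne'
  have hk : ∀ i, M.p s a i = 0 → x.transitions n s a i = 0 := fun i hi =>
    x.transitions_eq_zero fun t h1 h2 h3 => h t h1 h2 (h3 ▸ hi)
  have hNk : ∑ i, x.transitions n s a i = N := x.sum_transitions n s a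
  have hmain := exp_sum_mul_log_le (x.transitions n s a) (M.p_mem s a).1 hk
    (M.prod_laplaceRatio x hm h n)
  rw [hNk] at hmain
  have hac : ∀ i, M.p s a i = 0 → x.phat n s a i = 0 := fun i hi => by
    rw [hphat, hk i hi]
    simp
  have hNR : (N : ℝ) ≠ 0 := by positivity
  have hkl : (N : ℝ) * ∑ i, x.phat n s a i * Real.log (x.phat n s a i / M.p s a i) =
      ∑ i, x.transitions n s a i * Real.log ((x.transitions n s a i : ℝ) / N / M.p s a i) := by
    rw [Finset.mul_sum]
    refine Finset.sum_congr rfl fun i _ => ?_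
    rw [hphat, ← mul_assoc, mul_div_cancel₀ _ hNR]
  rw [kl, if_pos hac, ← EReal.coe_mul, EReal.coe_le_coe_iff, hkl, ← Real.exp_le_exp]
  calc _ ≤ _ := hmain
    _ ≤ (Fintype.card S * Fintype.card A / δ) *
        Real.exp (m * Real.log (Real.exp 1 * (1 + N / m))) :=
      mul_le_mul hW.le (choose_add_le_exp N m) (by positivity) hSA.le
    _ = Real.exp (threshold S A δ N) := by
      rw [threshold, hcm, Real.exp_add, Real.exp_log hSA]

end LaplaceWeight

end AvgRewardMDP

namespace AvgRewardMDP

/-! ### Ville's inequality for products of conditionally sub-unit factors -/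

section Ville

variable {Ω : Type*} {mΩ : MeasurableSpace Ω}

/-- The product of the factors `f 0, …, f (n - 1)`, frozen as soon as it reaches the level `c`. -/
noncomputable def stoppedProd (f : ℕ → Ω → ℝ) (c : ℝ) : ℕ → Ω → ℝ
  | 0, _ => 1
  | n + 1, ω =>
    if c ≤ stoppedProd f c n ω then stoppedProd f c n ω else stoppedProd f c n ω * f n ω

theorem stoppedProd_nonneg {f : ℕ → Ω → ℝ} (hf : ∀ n ω, 0 ≤ f n ω) (c : ℝ) (n : ℕ) (ω : Ω) :
    0 ≤ stoppedProd f c n ω := by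
  induction n with
  | zero => exact zero_le_one
  | succ n ih =>
    rw [stoppedProd]
    split_ifs
    exacts [ih, mul_nonneg ih (hf n ω)]

theorem stoppedProd_le {f : ℕ → Ω → ℝ} {C : ℝ} (hC : 1 ≤ C) (hf : ∀ n ω, 0 ≤ f n ω)
    (hfC : ∀ n ω, f n ω ≤ C) (c : ℝ) (n : ℕ) (ω : Ω) : stoppedProd f c n ω ≤ C ^ n := by
  induction n with
  | zero => simp [stoppedProd]
  | succ n ih =>
    rw [stoppedProd, pow_succ]
    split_ifs
    · exact ih.trans (le_mul_of_one_le_right (by positivity) hC)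
    · exact mul_le_mul ih (hfC n ω) (hf n ω) (by positivity)

theorem measurable_stoppedProd {ℱ : Filtration ℕ mΩ} {f : ℕ → Ω → ℝ}
    (hm : ∀ n, Measurable[ℱ (n + 1)] (f n)) (c : ℝ) (n : ℕ) :
    Measurable[ℱ n] (stoppedProd f c n) := by
  induction n with
  | zero => exact measurable_const
  | succ n ih =>
    have h := ih.mono (ℱ.mono n.le_succ) le_rfl
    exact Measurable.ite (measurableSet_le measurable_const h) h (h.mul (hm n))

/-- This is the purpose of freezing: the events of having reached c increase with n, so the measure
of their union is the supremum of their measures, and Markov's inequality at each fixed n suffices.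
-/
theorem le_stoppedProd_mono (f : ℕ → Ω → ℝ) (c : ℝ) (ω : Ω) :
    Monotone fun n => c ≤ stoppedProd f c n ω :=
  monotone_nat_of_le_succ fun n h => by
    rw [stoppedProd, if_pos h]
    exact h

/-- A frozen product that never reaches c coincides with the plain product at all times. -/
theorem exists_le_stoppedProd {f : ℕ → Ω → ℝ} {c : ℝ} {n : ℕ} {ω : Ω}
    (h : c ≤ ∏ t ∈ Finset.range n, f t ω) : ∃ m, c ≤ stoppedProd f c m ω := by
  by_contra! hlt
  have : ∀ m, stoppedProd f c m ω = ∏ t ∈ Finset.range m, f t ω := by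
    intro m
    induction m with
    | zero => rfl
    | succ m ih => rw [stoppedProd, if_neg (hlt m).not_ge, ih, Finset.prod_range_succ]
  exact absurd h (this n ▸ hlt n).not_ge

theorem integrable_of_measurable_of_bound {μ : Measure Ω} [IsFiniteMeasure μ] {g : Ω → ℝ} {C : ℝ}
    (hg : Measurable g) (h0 : ∀ ω, 0 ≤ g ω) (hC : ∀ ω, g ω ≤ C) : Integrable g μ :=
  Integrable.of_bound hg.aestronglyMeasurable C (ae_of_all _ fun ω => by
    rw [Real.norm_of_nonneg (h0 ω)]
    exact hC ω)

/-- The frozen product is a supermartingale started at 1. Its unfrozen part W is known at time n, so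
it can be pulled out of the conditional expectation: E[W f_n] ≤ E[W]. The bound C ^ n supplies
integrability. -/
theorem integral_stoppedProd_le {μ : Measure Ω} [IsProbabilityMeasure μ] {ℱ : Filtration ℕ mΩ}
    {f : ℕ → Ω → ℝ} {C : ℝ} (hC : 1 ≤ C) (hf : ∀ n ω, 0 ≤ f n ω) (hfC : ∀ n ω, f n ω ≤ C)
    (hm : ∀ n, Measurable[ℱ (n + 1)] (f n)) (hcond : ∀ n, μ[f n | ℱ n] ≤ᵐ[μ] fun _ => 1) (c : ℝ)
    (n : ℕ) : ∫ ω, stoppedProd f c n ω ∂μ ≤ 1 := by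
  have hmeas := measurable_stoppedProd hm c
  have hint : ∀ k, Integrable (stoppedProd f c k) μ := fun k =>
    integrable_of_measurable_of_bound ((hmeas k).mono (ℱ.le k) le_rfl) (stoppedProd_nonneg hf c k)
      (stoppedProd_le hC hf hfC c k)
  induction n with
  | zero => simp [stoppedProd]
  | succ n ih =>
    refine le_trans ?_ ih
    set V := stoppedProd f c n
    have hV0 : ∀ ω, 0 ≤ V ω := stoppedProd_nonneg hf c n
    have hVC : ∀ ω, V ω ≤ C ^ n := stoppedProd_le hC hf hfC c n
    have hE : MeasurableSet[ℱ n] {ω | c ≤ V ω} :=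
      measurableSet_le measurable_const (hmeas n)
    set W : Ω → ℝ := {ω | c ≤ V ω}ᶜ.indicator V
    have hW : Measurable[ℱ n] W := (hmeas n).indicator hE.compl
    have hW0 : ∀ ω, 0 ≤ W ω := fun ω => Set.indicator_nonneg (fun ω _ => hV0 ω) ω
    have hWC : ∀ ω, W ω ≤ C ^ n := fun ω =>
      (Set.indicator_le_self' (fun _ _ => hV0 _) ω).trans (hVC ω)
    have hfi : Integrable (f n) μ :=
      integrable_of_measurable_of_bound ((hm n).mono (ℱ.le _) le_rfl) (hf n) (hfC n)
    have hWi : Integrable W μ :=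
      integrable_of_measurable_of_bound (hW.mono (ℱ.le _) le_rfl) hW0 hWC
    have hpull : μ[W * f n | ℱ n] =ᵐ[μ] W * μ[f n | ℱ n] :=
      condExp_stronglyMeasurable_mul_of_bound (ℱ.le n) hW.stronglyMeasurable hfi (C ^ n)
        (ae_of_all _ fun ω => by
          rw [Real.norm_of_nonneg (hW0 ω)]
          exact hWC ω)
    have hprod : ∫ ω, (W * f n) ω ∂μ ≤ ∫ ω, W ω ∂μ := by
      rw [← integral_condExp (ℱ.le n), integral_congr_ae hpull]
      refine integral_mono_ae (integrable_condExp.congr hpull) hWi ?_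
      filter_upwards [hcond n] with ω hω
      exact mul_le_of_le_one_right (hW0 ω) hω
    have hWfi : Integrable (W * f n) μ := by
      refine integrable_of_measurable_of_bound (C := C ^ n * C)
        ((hW.mono (ℱ.le _) le_rfl).mul ((hm n).mono (ℱ.le _) le_rfl))
        (fun ω => mul_nonneg (hW0 ω) (hf n ω)) fun ω =>
          mul_le_mul (hWC ω) (hfC n ω) (hf n ω) (by positivity)
    have hsplit : ∀ ω, stoppedProd f c (n + 1) ω = V ω - W ω + (W * f n) ω := by
      intro ω
      rw [stoppedProd]
      by_cases h : c ≤ V ω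
      · have : W ω = 0 := Set.indicator_of_notMem (by simpa using h) _
        simp [h, this, V]
      · have : W ω = V ω := Set.indicator_of_mem (by simpa using h) _
        simp [h, this, V]
    calc ∫ ω, stoppedProd f c (n + 1) ω ∂μ = ∫ ω, (V ω - W ω + (W * f n) ω) ∂μ := by
          simp only [hsplit]
      _ = ∫ ω, V ω ∂μ - ∫ ω, W ω ∂μ + ∫ ω, (W * f n) ω ∂μ := by
          rw [← integral_sub (hint n) hWi]
          exact integral_add ((hint n).sub hWi) hWfi
      _ ≤ ∫ ω, V ω ∂μ := by linarith

/-- Ville's inequality for partial products of nonnegative bounded factors whose conditional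
expectations are at most one. -/
theorem measure_exists_le_prod_le {μ : Measure Ω} [IsProbabilityMeasure μ] {ℱ : Filtration ℕ mΩ}
    {f : ℕ → Ω → ℝ} {C : ℝ} (hC : 1 ≤ C) (hf : ∀ n ω, 0 ≤ f n ω) (hfC : ∀ n ω, f n ω ≤ C)
    (hm : ∀ n, Measurable[ℱ (n + 1)] (f n)) (hcond : ∀ n, μ[f n | ℱ n] ≤ᵐ[μ] fun _ => 1) {c : ℝ}
    (hc : 0 < c) :
    μ {ω | ∃ n, c ≤ ∏ t ∈ Finset.range n, f t ω} ≤ ENNReal.ofReal c⁻¹ := by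
  have hsub : {ω | ∃ n, c ≤ ∏ t ∈ Finset.range n, f t ω} ⊆
      ⋃ n, {ω | c ≤ stoppedProd f c n ω} := by
    rintro ω ⟨n, hn⟩
    exact Set.mem_iUnion.2 (exists_le_stoppedProd hn)
  refine (measure_mono hsub).trans ?_
  have hmono : Monotone fun n => {ω | c ≤ stoppedProd f c n ω} :=
    fun m n hmn ω => le_stoppedProd_mono f c ω hmn
  rw [hmono.measure_iUnion]
  refine iSup_le fun n => ?_
  have hint : Integrable (stoppedProd f c n) μ :=
    integrable_of_measurable_of_bound ((measurable_stoppedProd hm c n).mono (ℱ.le n) le_rfl)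
      (stoppedProd_nonneg hf c n) (stoppedProd_le hC hf hfC c n)
  have h1 := (mul_meas_ge_le_integral_of_nonneg
    (ae_of_all μ (stoppedProd_nonneg hf c n)) hint c).trans
    (integral_stoppedProd_le hC hf hfC hm hcond c n)
  rw [← ofReal_measureReal]
  refine ENNReal.ofReal_le_ofReal ?_
  rw [← one_div, le_div_iff₀ hc, mul_comm]
  exact h1

end Ville

end AvgRewardMDP

namespace AvgRewardMDP

/-! ### Time-uniform validity of the confidence sets -/

section Coverage

theorem IsRun.measurableSet_pair {S A : Type*} [Fintype S] {M : MDP S A} {model : Model} {Ω : Type*}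
    [mΩ : MeasurableSpace Ω] {μ : Measure Ω} {ℱ : Filtration ℕ mΩ} {X : Ω → Trajectory S A}
    (hX : IsRun M model μ ℱ X) {t n : ℕ} (htn : t ≤ n) (s : S) (a : A) :
    MeasurableSet[ℱ n] {ω | (X ω).state t = s ∧ (X ω).action t = a} :=
  ℱ.mono htn _ ((hX.state_adapted t s).inter (hX.action_adapted t a))

/-- Almost surely, no transition of probability zero is observed. -/
theorem IsRun.ae_p_next_ne_zero {S A : Type*} [Fintype S] {M : MDP S A} {model : Model} {Ω : Type*}
    [mΩ : MeasurableSpace Ω] {μ : Measure Ω} {ℱ : Filtration ℕ mΩ} {X : Ω → Trajectory S A}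
    [Fintype A] [IsProbabilityMeasure μ] (hX : IsRun M model μ ℱ X) :
    ∀ᵐ ω ∂μ, ∀ t, M.p ((X ω).state t) ((X ω).action t) ((X ω).next t) ≠ 0 := by
  have hnull : ∀ t s a i, M.p s a i = 0 →
      ∀ᵐ ω ∂μ, ¬(((X ω).state t = s ∧ (X ω).action t = a) ∧ (X ω).next t = i) := by
    intro t s a i h0
    have hE := hX.measurableSet_pair (le_refl t) s a
    have hN := ℱ.le _ _ (hX.next_adapted t i)
    -- Integrating the conditional law of the next state over the event that (s,a) is sampled gives
    -- the probability of the joint event, here 0.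
    have h1 := setIntegral_condExp (ℱ.le t)
      ((integrable_const (1 : ℝ)).indicator (μ := μ) hN) hE
    rw [setIntegral_congr_ae (g := fun _ => 0) (ℱ.le t _ hE) (by
      filter_upwards [hX.next_law t i] with ω hω hωE
      rw [hω, hωE.1, hωE.2, h0]), integral_zero, integral_indicator_const _ hN,
      smul_eq_mul, mul_one, measureReal_restrict_apply hN, eq_comm, measureReal_eq_zero_iff] at h1
    rw [ae_iff]
    convert h1 using 2
    ext ω
    exact not_not.trans and_comm
  have := ae_all_iff.2 fun t => ae_all_iff.2 fun s => ae_all_iff.2 fun a => ae_all_iff.2 fun i =>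
    eventually_imp_distrib_left.2 (hnull t s a i)
  filter_upwards [this] with ω hω t h0
  exact hω t _ _ _ h0 ⟨⟨rfl, rfl⟩, rfl⟩

variable {S A : Type*} [Fintype S] [DecidableEq S] [DecidableEq A]

theorem MDP.laplaceRatio_nonneg (M : MDP S A) (x : Trajectory S A) (s : S) (a : A) (t : ℕ) (i : S) :
    0 ≤ M.laplaceRatio x s a t i := by
  rw [MDP.laplaceRatio]
  split_ifs
  · have := (M.p_mem s a).1 i
    positivity
  · exact zero_le_one

theorem Trajectory.transitions_le_visits (x : Trajectory S A) (n : ℕ) (s : S) (a : A) (i : S) :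
    x.transitions n s a i ≤ x.visits n s a :=
  x.sum_transitions n s a ▸ Finset.single_le_sum (fun _ _ => Nat.zero_le _) (Finset.mem_univ i)

/-- Any deterministic bound serves, as it is used only for integrability. The Laplace estimate is at
most 1, a zero probability has inverse 0 by convention, and the summand 1 covers steps at other
pairs. -/
theorem MDP.laplaceRatio_le (M : MDP S A) (x : Trajectory S A) (s : S) (a : A) (t : ℕ) (i : S) :
    M.laplaceRatio x s a t i ≤ 1 + ∑ j, (M.p s a j)⁻¹ := by
  have h0 : ∀ j ∈ Finset.univ, 0 ≤ (M.p s a j)⁻¹ := fun j _ => inv_nonneg.2 ((M.p_mem s a).1 j)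
  have h1 : (M.p s a i)⁻¹ ≤ ∑ j, (M.p s a j)⁻¹ := Finset.single_le_sum h0 (Finset.mem_univ i)
  rw [MDP.laplaceRatio]
  split_ifs
  · have hS : (1 : ℝ) ≤ Fintype.card S := by
      exact_mod_cast Fintype.card_pos_iff.2 ⟨i⟩
    have hk : (x.transitions t s a i : ℝ) ≤ x.visits t s a := by
      exact_mod_cast x.transitions_le_visits t s a i
    have h2 : ((x.transitions t s a i + 1 : ℝ) / (x.visits t s a + Fintype.card S)) ≤ 1 := by
      rw [div_le_one (by positivity)]
      linarith
    rw [div_eq_mul_inv]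
    calc _ ≤ 1 * (M.p s a i)⁻¹ := mul_le_mul_of_nonneg_right h2 (h0 i (Finset.mem_univ i))
      _ ≤ _ := by linarith
  · linarith [Finset.sum_nonneg h0]

/-- Under the true transition vector, the expected likelihood ratio is at most one. -/
theorem MDP.sum_laplaceRatio_mul_le (M : MDP S A) (x : Trajectory S A) (s : S) (a : A) (t : ℕ) :
    ∑ i, M.laplaceRatio x s a t i * M.p (x.state t) (x.action t) i ≤ 1 := by
  by_cases h : x.state t = s ∧ x.action t = a
  · have hS : (0 : ℝ) < Fintype.card S := by
      exact_mod_cast Fintype.card_pos_iff.2 ⟨s⟩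
    have hpos : (0 : ℝ) < x.visits t s a + Fintype.card S := by positivity
    simp only [MDP.laplaceRatio, h.1, h.2, and_self, if_true]
    calc _ ≤ ∑ i, (x.transitions t s a i + 1 : ℝ) / (x.visits t s a + Fintype.card S) := by
          refine Finset.sum_le_sum fun i _ => ?_
          -- States of probability zero contribute 0 instead of their Laplace mass, hence an
          -- inequality rather than an equality.
          rcases eq_or_ne (M.p s a i) 0 with h0 | h0
          · rw [h0, mul_zero]
            positivity
          · rw [div_mul_cancel₀ _ h0]
      _ = 1 := by
          rw [← Finset.sum_div, Finset.sum_add_distrib, ← Nat.cast_sum, x.sum_transitions]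
          simp only [Finset.sum_const, Finset.card_univ, nsmul_eq_mul, mul_one]
          exact div_self hpos.ne'
  · simp only [MDP.laplaceRatio, if_neg h, one_mul]
    exact (M.p_mem _ _).2.le

/-- Splits the factor into terms known before step t times indicators of the next state, the form to
which `next_law` applies. -/
theorem MDP.laplaceRatio_next_eq_sum (M : MDP S A) {Ω : Type*} (X : Ω → Trajectory S A)
    (s : S) (a : A) (t : ℕ) :
    (fun ω => M.laplaceRatio (X ω) s a t ((X ω).next t)) =
      ∑ i, (fun ω => M.laplaceRatio (X ω) s a t i) *
        Set.indicator {ω | (X ω).next t = i} (fun _ => (1 : ℝ)) := by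
  ext ω
  simp [Finset.sum_apply, Set.indicator_apply]

variable {M : MDP S A} {model : Model} {Ω : Type*} [mΩ : MeasurableSpace Ω] {μ : Measure Ω}
  {ℱ : Filtration ℕ mΩ} {X : Ω → Trajectory S A}

theorem IsRun.measurable_visits (hX : IsRun M model μ ℱ X) (n : ℕ) (s : S) (a : A) :
    Measurable[ℱ n] fun ω => ((X ω).visits n s a : ℝ) := by
  simp only [Trajectory.visits, Finset.card_filter, Nat.cast_sum]
  refine Finset.measurable_fun_sum _ fun t ht => ?_
  simp only [Nat.cast_ite]
  exact Measurable.ite (hX.measurableSet_pair (Finset.mem_range.1 ht).le s a) measurable_const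
    measurable_const

theorem IsRun.measurable_transitions (hX : IsRun M model μ ℱ X) (n : ℕ) (s : S) (a : A) (i : S) :
    Measurable[ℱ n] fun ω => ((X ω).transitions n s a i : ℝ) := by
  simp only [Trajectory.transitions, Finset.card_filter, Nat.cast_sum]
  refine Finset.measurable_fun_sum _ fun t ht => ?_
  have h : MeasurableSet[ℱ n] {ω | (X ω).state t = s ∧ (X ω).action t = a ∧ (X ω).next t = i} := by
    have := (hX.measurableSet_pair (Finset.mem_range.1 ht).le s a).inter
      (ℱ.mono (Finset.mem_range.1 ht) _ (hX.next_adapted t i))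
    convert this using 1
    ext ω
    simp [and_assoc]
  simp only [Nat.cast_ite]
  exact Measurable.ite h measurable_const measurable_const

theorem IsRun.measurable_laplaceRatio (hX : IsRun M model μ ℱ X) (s : S) (a : A) (t : ℕ) (i : S) :
    Measurable[ℱ t] fun ω => M.laplaceRatio (X ω) s a t i := by
  unfold MDP.laplaceRatio
  exact Measurable.ite (hX.measurableSet_pair le_rfl s a)
    ((((hX.measurable_transitions t s a i).add_const 1).div
      ((hX.measurable_visits t s a).add_const _)).div_const _) measurable_const

theorem IsRun.measurable_laplaceRatio_next (hX : IsRun M model μ ℱ X) (s : S) (a : A) (t : ℕ) :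
    Measurable[ℱ (t + 1)] fun ω => M.laplaceRatio (X ω) s a t ((X ω).next t) := by
  rw [M.laplaceRatio_next_eq_sum]
  rw [Finset.sum_fn]
  exact Finset.measurable_fun_sum _ fun i _ =>
    ((hX.measurable_laplaceRatio s a t i).mono (ℱ.mono t.le_succ) le_rfl).mul
      (measurable_const.indicator (hX.next_adapted t i))

variable [IsProbabilityMeasure μ]

theorem IsRun.condExp_laplaceRatio_le (hX : IsRun M model μ ℱ X) (s : S) (a : A) (t : ℕ) :
    μ[fun ω => M.laplaceRatio (X ω) s a t ((X ω).next t) | ℱ t] ≤ᵐ[μ] fun _ => 1 := by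
  rw [M.laplaceRatio_next_eq_sum]
  have hind : ∀ i, Integrable (Set.indicator {ω | (X ω).next t = i} fun _ => (1 : ℝ)) μ := fun i =>
    (integrable_const _).indicator (ℱ.le _ _ (hX.next_adapted t i))
  have hbound : ∀ i ω, ‖M.laplaceRatio (X ω) s a t i‖ ≤ 1 + ∑ j, (M.p s a j)⁻¹ := fun i ω => by
    rw [Real.norm_of_nonneg (M.laplaceRatio_nonneg _ s a t i)]
    exact M.laplaceRatio_le _ s a t i
  have hmeas := fun i => hX.measurable_laplaceRatio s a t i
  have hpull : ∀ i, μ[(fun ω => M.laplaceRatio (X ω) s a t i) *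
      Set.indicator {ω | (X ω).next t = i} (fun _ => (1 : ℝ)) | ℱ t] =ᵐ[μ]
      fun ω => M.laplaceRatio (X ω) s a t i * M.p ((X ω).state t) ((X ω).action t) i := by
    intro i
    refine (condExp_stronglyMeasurable_mul_of_bound (ℱ.le t) (hmeas i).stronglyMeasurable (hind i)
      _ (ae_of_all _ (hbound i))).trans ?_
    filter_upwards [hX.next_law t i] with ω hω
    rw [Pi.mul_apply, hω]
  have hint : ∀ i ∈ Finset.univ, Integrable ((fun ω => M.laplaceRatio (X ω) s a t i) *
      Set.indicator {ω | (X ω).next t = i} (fun _ => (1 : ℝ))) μ := fun i _ =>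
    (hind i).bdd_mul ((hmeas i).mono (ℱ.le t) le_rfl).aestronglyMeasurable
      (ae_of_all _ (hbound i))
  filter_upwards [condExp_finsetSum hint (ℱ t), ae_all_iff.2 hpull] with ω h1 h2
  rw [h1, Finset.sum_apply, Finset.sum_congr rfl fun i _ => h2 i]
  exact M.sum_laplaceRatio_mul_le (X ω) s a t

theorem IsRun.measure_exists_le_prod_laplaceRatio (hX : IsRun M model μ ℱ X)
    (s : S) (a : A) {c : ℝ} (hc : 0 < c) :
    μ {ω | ∃ n, c ≤ ∏ t ∈ Finset.range n, M.laplaceRatio (X ω) s a t ((X ω).next t)} ≤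
      ENNReal.ofReal c⁻¹ := by
  refine measure_exists_le_prod_le (C := 1 + ∑ j, (M.p s a j)⁻¹) ?_
    (fun t ω => M.laplaceRatio_nonneg _ s a t _) (fun t ω => M.laplaceRatio_le _ s a t _)
    (fun t => hX.measurable_laplaceRatio_next s a t) (fun t => hX.condExp_laplaceRatio_le s a t) hc
  linarith [Finset.sum_nonneg fun j (_ : j ∈ Finset.univ) => inv_nonneg.2 ((M.p_mem s a).1 j)]

/-- With probability at least `1 - δ`, the confidence sets contain the true transition vectors at
all times. -/
theorem IsRun.measure_exists_notMem_confSet_le [Fintype A] [Nonempty S] [Nonempty A] (hX : IsRun M model μ ℱ X)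
    {δ : ℝ}
    (hδ : 0 < δ) (hδ1 : δ ≤ 1) :
    μ {ω | ∃ n s a, M.p s a ∉ (X ω).confSet δ n s a} ≤ ENNReal.ofReal δ := by
  set c : ℝ := Fintype.card S * Fintype.card A / δ with hc
  have hS : (0 : ℝ) < Fintype.card S := by exact_mod_cast Fintype.card_pos (α := S)
  have hA : (0 : ℝ) < Fintype.card A := by exact_mod_cast Fintype.card_pos (α := A)
  have hcpos : 0 < c := by positivity
  set B : S × A → Set Ω := fun z =>
    {ω | ∃ n, c ≤ ∏ t ∈ Finset.range n, M.laplaceRatio (X ω) z.1 z.2 t ((X ω).next t)} with hB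
  -- The inclusion is only almost sure: the passage from W to the divergence requires that no
  -- transition of probability zero was observed.
  have hsub : {ω | ∃ n s a, M.p s a ∉ (X ω).confSet δ n s a} ≤ᵐ[μ] ⋃ z, B z := by
    filter_upwards [hX.ae_p_next_ne_zero] with ω hω
    rintro ⟨n, s, a, hn⟩
    refine Set.mem_iUnion.2 ⟨(s, a), n, ?_⟩
    by_contra! hlt
    refine hn (M.p_mem_confSet (X ω) hδ hδ1 (fun t h1 h2 => ?_) hlt)
    have := hω t
    rwa [h1, h2] at this
  calc μ {ω | ∃ n s a, M.p s a ∉ (X ω).confSet δ n s a} ≤ μ (⋃ z, B z) := measure_mono_ae hsub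
    _ ≤ ∑ z, μ (B z) := measure_iUnion_fintype_le μ B
    _ ≤ ∑ _z : S × A, ENNReal.ofReal c⁻¹ :=
        Finset.sum_le_sum fun z _ => hX.measure_exists_le_prod_laplaceRatio z.1 z.2 hcpos
    _ = ENNReal.ofReal δ := by
        rw [Finset.sum_const, Finset.card_univ, ← ENNReal.ofReal_nsmul, Fintype.card_prod,
          nsmul_eq_mul, hc]
        congr 1
        push_cast
        field_simp

end Coverage

end AvgRewardMDP

/-! ### Near-optimality of the recommended policy at the stopping time -/

theorem mainTheorem4 {S A : Type*} [Fintype S] [Fintype A] [DecidableEq S] [DecidableEq A]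
    [Nonempty S] [Nonempty A] (M : AvgRewardMDP.MDP S A) (model : AvgRewardMDP.Model)
    {Ω : Type*} [mΩ : MeasurableSpace Ω] (μ : MeasureTheory.Measure Ω)
    [MeasureTheory.IsProbabilityMeasure μ]
    -- the data collected by an arbitrary sampling rule
    (ℱ : MeasureTheory.Filtration ℕ mΩ) (X : Ω → AvgRewardMDP.Trajectory S A)
    (hX : AvgRewardMDP.IsRun M model μ ℱ X)
    -- an arbitrary, possibly random and data-dependent, sequence of bias vectors
    (b : ℕ → Ω → S → ℝ)
    (ε δ : ℝ) (hε : 0 < ε) (hδ : 0 < δ) (hδ1 : δ < 1)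
    -- the recommendation, with arbitrary tie-breaking
    (τ : Ω → ℕ∞) (hτ : ∀ ω, τ ω = M.tau (X ω) (fun n => b n ω) ε δ)
    (πhat : Ω → S → A)
    (hπ : ∀ ω, ∀ n : ℕ, τ ω = n → M.IsRecommended (X ω) δ n (b n ω) (πhat ω)) :
    μ {ω | τ ω < ⊤ ∧ ∃ s, M.optGain - M.gain (AvgRewardMDP.detPolicy (πhat ω)) s > ε}
      ≤ ENNReal.ofReal δ := by
  -- Monotonicity of μ holds for arbitrary sets, so neither b nor the recommendation has to be
  -- measurable.
  refine (measure_mono ?_).trans (hX.measure_exists_notMem_confSet_le hδ hδ1.le)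
  rintro ω ⟨hlt, s, hs⟩
  by_contra hconf
  simp only [Set.mem_ofPred_eq, not_exists, not_not] at hconf
  obtain ⟨n, hn, hgap⟩ := M.exists_tau_eq (X ω) (fun n => b n ω) ε δ (hτ ω ▸ hlt)
  exact hs.not_ge (M.optGain_sub_gain_le (X ω) (hconf n) hgap (hπ ω n ((hτ ω).trans hn)) s)
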